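/- **Setting.** Let $(\Omega,\mathcal F,(\mathcal F_t)_{t\ge 0},Q)$ be a filtered probability space satisfying the usual conditions, carrying a one-dimensional $(\mathcal F_t)$-Brownian motion $W$. Fix $x_0>0$ and $\alpha\in[0,1]$. Consider functions $\sigma:[0,\infty)\times(0,\infty)\to(0,\infty)$ such that - $\sigma$ is continuous; for every $L>0$ there is $C\ge 0$ with $|\sigma(t,x)-\sigma(t,y)|\le C|x-y|^{1/2}$ for $(t,x,y)\in[0,L]\times[L^{-1},L]^2$; and $\sigma$ is bounded on $[0,\infty)\times(0,1]$; - there are $0=\tau_0<\tau_1<\dots$ such that for each $n$, on $[\tau_n,\tau_{n+1}]$, either $\sigma(\cdot,x)$ is increasing for all $x>0$ or $\sigma(\cdot,x)$ is decreasing for all $x>0$ (both in the weak sense). For such $\sigma$ let $X$ be the nonnegative continuous solution of $dX_t=\sigma(t,X_t)\,dW_t$, $X_0=x_0$ (with $\sigma(t,0):=0$, that is, absorbed if it reaches $0$), and put $$C^{\sigma}(T,K)=\mathbb E^Q[(X_T-K)^+]+\alpha\,(x_0-\mathbb E^Q[X_T]),\qquad T\ge 0,\ K>0 .$$ Let $C^{1,2}$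 be the space of continuous $f:[0,\infty)\times(0,\infty)\to\mathbb R$ whose derivatives $\partial_t f,\partial_x f,\partial_{xx}f$ exist and are continuous on $(0,\infty)\times(0,\infty)$, with the Fréchet topology given by the seminorms $\sup_{[0,n]\times[1/n,n]}|f|$ and $\sup_{[1/n,n]^2}|\partial f|$, $\partial\in\{\partial_t,\partial_x,\partial_{xx}\}$, $n\ge1$. Let $\mathcal X\subset C^{1,2}$ be the set of all $C^\sigma\in C^{1,2}$, with $\sigma$ as above, such that $\partial_{KK}C^\sigma>0$ on $(0,\infty)\times(0,\infty)$; give $\mathcal X$ the induced topology and Borel $\sigma$-algebra. Let $F:\mathcal X\to\{0,1\}$ be the bubble-detection function: $F(C^\sigma)=1$ if $X$ is a strict local martingale (a local martingale that is not a martingale), and $F(C^\sigma)=0$ otherwise. For fixed $\delta,C>0$ let $A=[0,\infty)\times(0,\delta]$ if $\alpha<1$ and $A=[0,\infty)\times[C,\infty)$ if $\alpha=1$. Let $(T_i,K_i)_{i\ge1}$ be a sequence in $A$ whose range is dense in $A$. Let $\mu$ be a probability measure on $\mathcal X$ for which there exists a probability measure $\nu$ on $\mathcal X$ with $$\nu\big(\{f\in\mathcal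 X: f(T_i,K_i)=g(T_i,K_i)\text{ for all }i\}\big)>0\qquad\text{for every } g\in\operatorname{supp}(\mu).$$ **Neural networks.** Given a number of layers $L\ge2$, an inner activation function $\varsigma:\mathbb R\to\mathbb R$ that is bounded, continuous and non-constant, and an outer activation function $\psi$ that is Lipschitz continuous and a bijection from $\mathbb R$ onto $(0,1)$, a neural network $\mathbb R^n\to[0,1]$ is a function $\psi\circ W_L\circ(\varsigma\circ W_{L-1})\circ\dots\circ(\varsigma\circ W_1)$ with affine maps $W_\ell:\mathbb R^{N_{\ell-1}}\to\mathbb R^{N_\ell}$, $N_0=n$, $N_L=1$, $N_1,\dots,N_{L-1}\ge1$, and $\varsigma$ applied componentwise. **Theorem.** Let $L,\varsigma,\psi$ be given as above. For every $p\in[1,\infty)$ and $\epsilon>0$ there exist $n\ge 1$ and a neural network $\hat F^n:\mathbb R^n\to[0,1]$ with these activation functions and number of layers such that $$\Big(\int_{\mathcal X}\big|\hat F^n(g(T_1,K_1),\dots,g(T_n,K_n))-F(g)\big|^p\,d\mu(g)\Big)^{1/p}<\epsilon ,$$ where the integrand is measurable and integrable. -/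

import Mathlib

open MeasureTheory ProbabilityTheory Filter Topology
open scoped NNReal ENNReal

/-! ### Stochastic basis, local martingales, stochastic integral -/

/-- The usual conditions: right-continuity and completeness. -/
structure UsualConditions {Ω : Type*} [mΩ : MeasurableSpace Ω] (Q : Measure Ω)
    (𝓕 : Filtration ℝ≥0 mΩ) : Prop where
  rightContinuous : 𝓕.IsRightContinuous
  complete : ∀ (t : ℝ≥0) (N : Set Ω), Q N = 0 → MeasurableSet[𝓕 t] N

/-- `W` is a one-dimensional Brownian motion relative to the filtration `𝓕`. -/
structure IsFiltrationBrownian {Ω : Type*} [mΩ : MeasurableSpace Ω] (Q : Measure Ω)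
    (𝓕 : Filtration ℝ≥0 mΩ) (W : ℝ≥0 → Ω → ℝ) : Prop where
  brownian : IsBrownianReal W Q
  adapted : StronglyAdapted 𝓕 W
  indep : ∀ s t : ℝ≥0, s ≤ t →
    Indep (MeasurableSpace.comap (fun ω => W t ω - W s ω) inferInstance) (𝓕 s) Q

/-- Local martingales: martingale along a localizing sequence of stopping times. -/
def IsLocalMartingale {Ω : Type*} [mΩ : MeasurableSpace Ω] (Q : Measure Ω)
    (𝓕 : Filtration ℝ≥0 mΩ) (M : ℝ≥0 → Ω → ℝ) : Prop :=
  Locally (fun Y => Martingale Y 𝓕 Q) 𝓕 M Q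

/-- A strict local martingale is a local martingale that is not a martingale. -/
def IsStrictLocalMartingale {Ω : Type*} [mΩ : MeasurableSpace Ω] (Q : Measure Ω)
    (𝓕 : Filtration ℝ≥0 mΩ) (M : ℝ≥0 → Ω → ℝ) : Prop :=
  IsLocalMartingale Q 𝓕 M ∧ ¬ Martingale M 𝓕 Q

/-- `I = ∫ H dW`, the Itô integral of an adapted, pathwise locally square integrable process `H`.
It is characterized through brackets: `I` is the continuous local martingale started at `0` with
`⟨I⟩ = ∫ H² ds` and `⟨I, W⟩ = ∫ H ds`; these two identities together say that the bracket of
`I - ∫ H dW` is zero. -/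
structure IsItoIntegral {Ω : Type*} [mΩ : MeasurableSpace Ω] (Q : Measure Ω)
    (𝓕 : Filtration ℝ≥0 mΩ) (W H I : ℝ≥0 → Ω → ℝ) : Prop where
  adapted_integrand : StronglyAdapted 𝓕 H
  sq_integrable : ∀ᵐ ω ∂Q, ∀ t : ℝ≥0, MemLp (fun s : ℝ => H s.toNNReal ω) 2 (volume.restrict (Set.Icc 0 (t : ℝ)))
  adapted : StronglyAdapted 𝓕 I
  continuous_paths : ∀ᵐ ω ∂Q, Continuous (fun t => I t ω)
  zero : ∀ᵐ ω ∂Q, I 0 ω = 0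
  localMartingale : IsLocalMartingale Q 𝓕 I
  bracket_self : IsLocalMartingale Q 𝓕
    (fun t ω => I t ω ^ 2 - ∫ s in (0 : ℝ)..t, H s.toNNReal ω ^ 2)
  bracket_brownian : IsLocalMartingale Q 𝓕
    (fun t ω => I t ω * W t ω - ∫ s in (0 : ℝ)..t, H s.toNNReal ω)

/-! ### Local volatility models -/

/-- The standing assumptions on the local volatility function
`σ : [0,∞) × (0,∞) → (0,∞)` (values of `σ` outside this domain are irrelevant). -/
structure IsLocalVolatility (σ : ℝ → ℝ → ℝ) : Prop where
  pos : ∀ t x : ℝ, 0 ≤ t → 0 < x → 0 < σ t x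
  continuousOn : ContinuousOn (Function.uncurry σ) (Set.Ici 0 ×ˢ Set.Ioi 0)
  holder : ∀ L : ℝ, 0 < L → ∃ C : ℝ, 0 ≤ C ∧
    ∀ t ∈ Set.Icc 0 L, ∀ x ∈ Set.Icc L⁻¹ L, ∀ y ∈ Set.Icc L⁻¹ L,
      |σ t x - σ t y| ≤ C * √|x - y|
  bounded_near_zero : ∃ A : ℝ, 0 ≤ A ∧ ∀ t x : ℝ, 0 ≤ t → 0 < x → x ≤ 1 → σ t x ≤ A
  piecewise_monotone : ∃ τ : ℕ → ℝ, τ 0 = 0 ∧ StrictMono τ ∧ ∀ n : ℕ,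
    (∀ x : ℝ, 0 < x → MonotoneOn (fun t => σ t x) (Set.Icc (τ n) (τ (n + 1)))) ∨
    (∀ x : ℝ, 0 < x → AntitoneOn (fun t => σ t x) (Set.Icc (τ n) (τ (n + 1))))

/-- The coefficient `σ(t, X_t)` along the process `X`, with `σ(t, 0) = 0`. -/
noncomputable def volatilityAlong {Ω : Type*} (σ : ℝ → ℝ → ℝ) (X : ℝ≥0 → Ω → ℝ) :
    ℝ≥0 → Ω → ℝ :=
  fun t ω => if 0 < X t ω then σ (t : ℝ) (X t ω) else 0

/-- `X` is a nonnegative continuous solution of `dX_t = σ(t, X_t) dW_t`, `X_0 = x₀`.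
The volatility `σ(t, 0)` is `0`, so that `X` is absorbed if it reaches `0`. -/
structure IsLocalVolSolution {Ω : Type*} [mΩ : MeasurableSpace Ω] (Q : Measure Ω)
    (𝓕 : Filtration ℝ≥0 mΩ) (W : ℝ≥0 → Ω → ℝ) (x₀ : ℝ) (σ : ℝ → ℝ → ℝ)
    (X : ℝ≥0 → Ω → ℝ) : Prop where
  nonneg : ∀ᵐ ω ∂Q, ∀ t : ℝ≥0, 0 ≤ X t ω
  sde : IsItoIntegral Q 𝓕 W (volatilityAlong σ X) (fun t ω => X t ω - x₀)

/-- The collateralized call price `E[(X_T - K)⁺] + α (x₀ - E[X_T])`. -/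
noncomputable def callPrice {Ω : Type*} [MeasurableSpace Ω] (Q : Measure Ω) (x₀ α : ℝ)
    (X : ℝ≥0 → Ω → ℝ) (T : ℝ≥0) (K : ℝ) : ℝ :=
  (∫ ω, max (X T ω - K) 0 ∂Q) + α * (x₀ - ∫ ω, X T ω ∂Q)

/-! ### The space of price surfaces -/

/-- Real functions `f(t, x)` continuous on `[0,∞) × (0,∞)` whose derivatives `∂_t f`, `∂_x f`,
`∂_xx f` exist and are continuous on `(0,∞) × (0,∞)`. A function on `[0,∞) × (0,∞)` is represented
by its extension by zero to the plane. -/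
@[ext]
structure C12 where
  toFun : ℝ → ℝ → ℝ
  eq_zero_outside : ∀ t x : ℝ, ¬ (0 ≤ t ∧ 0 < x) → toFun t x = 0
  continuousOn : ContinuousOn (Function.uncurry toFun) (Set.Ici 0 ×ˢ Set.Ioi 0)
  differentiable_t : ∀ t x : ℝ, 0 < t → 0 < x → DifferentiableAt ℝ (fun s => toFun s x) t
  differentiable_x : ∀ t x : ℝ, 0 < t → 0 < x → DifferentiableAt ℝ (toFun t) x
  differentiable_xx : ∀ t x : ℝ, 0 < t → 0 < x → DifferentiableAt ℝ (deriv (toFun t)) x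
  continuousOn_t : ContinuousOn (fun p : ℝ × ℝ => deriv (fun s => toFun s p.2) p.1)
    (Set.Ioi 0 ×ˢ Set.Ioi 0)
  continuousOn_x : ContinuousOn (fun p : ℝ × ℝ => deriv (toFun p.1) p.2)
    (Set.Ioi 0 ×ˢ Set.Ioi 0)
  continuousOn_xx : ContinuousOn (fun p : ℝ × ℝ => deriv (deriv (toFun p.1)) p.2)
    (Set.Ioi 0 ×ˢ Set.Ioi 0)

namespace C12

/-- The functions `f`, `∂_t f`, `∂_x f`, `∂_xx f` (in this order). -/
noncomputable def partialDeriv (f : C12) : Fin 4 → ℝ × ℝ → ℝ :=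
  ![fun p => f.toFun p.1 p.2,
    fun p => deriv (fun s => f.toFun s p.2) p.1,
    fun p => deriv (f.toFun p.1) p.2,
    fun p => deriv (deriv (f.toFun p.1)) p.2]

/-- The compact sets over which suprema are taken: `[0,n] × [1/n,n]` for `f` itself and
`[1/n,n] × [1/n,n]` for its derivatives. -/
def region (j : Fin 4) (n : ℕ) : Set (ℝ × ℝ) :=
  if j = 0 then Set.Icc 0 (n : ℝ) ×ˢ Set.Icc (n : ℝ)⁻¹ n
  else Set.Icc (n : ℝ)⁻¹ n ×ˢ Set.Icc (n : ℝ)⁻¹ n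

/-- The seminorm with index `(j, n)` of the difference `f - g`. -/
noncomputable def seminormDist (j : Fin 4) (n : ℕ) (f g : C12) : ℝ :=
  sSup ((fun p => |f.partialDeriv j p - g.partialDeriv j p|) '' region j n)

/-- The Fréchet topology, generated by the balls of the seminorms. -/
instance : TopologicalSpace C12 :=
  TopologicalSpace.generateFrom
    {U | ∃ (j : Fin 4) (n : ℕ) (g : C12) (r : ℝ), 1 ≤ n ∧ U = {f | seminormDist j n f g < r}}

instance : MeasurableSpace C12 := borel C12

instance : BorelSpace C12 := ⟨rfl⟩

end C12

/-- `f` is the price surface `C^σ`, computed with the local volatility process `X`, of some `σ` in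
the class `Σ`: `σ` satisfies the standing assumptions, `X` solves the equation with volatility `σ`,
`f` is the call price on `X`, and `∂_KK f > 0`. -/
structure IsPriceSurface {Ω : Type*} [mΩ : MeasurableSpace Ω] (Q : Measure Ω)
    (𝓕 : Filtration ℝ≥0 mΩ) (W : ℝ≥0 → Ω → ℝ) (x₀ α : ℝ) (σ : ℝ → ℝ → ℝ)
    (X : ℝ≥0 → Ω → ℝ) (f : C12) : Prop where
  volatility : IsLocalVolatility σ
  solution : IsLocalVolSolution Q 𝓕 W x₀ σ X
  price : ∀ (T : ℝ≥0) (K : ℝ), 0 < K → f.toFun T K = callPrice Q x₀ α X T K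
  convex : ∀ T K : ℝ, 0 < T → 0 < K → 0 < deriv (deriv (f.toFun T)) K

/-- The space `𝒳 = {C^σ : σ ∈ Σ}` with the topology and Borel σ-algebra induced by `C12`. -/
def priceSpace {Ω : Type*} [mΩ : MeasurableSpace Ω] (Q : Measure Ω)
    (𝓕 : Filtration ℝ≥0 mΩ) (W : ℝ≥0 → Ω → ℝ) (x₀ α : ℝ) : Set C12 :=
  {f | ∃ σ X, IsPriceSurface Q 𝓕 W x₀ α σ X f}

open Classical in
/-- The bubble-detection function `F`: `F(C^σ) = 1` if the price process of the underlying is a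
strict local martingale, and `F(C^σ) = 0` otherwise. -/
noncomputable def bubbleIndicator {Ω : Type*} [mΩ : MeasurableSpace Ω] (Q : Measure Ω)
    (𝓕 : Filtration ℝ≥0 mΩ) (W : ℝ≥0 → Ω → ℝ) (x₀ α : ℝ)
    (f : priceSpace Q 𝓕 W x₀ α) : ℝ :=
  if ∃ σ X, IsPriceSurface Q 𝓕 W x₀ α σ X f.1 ∧ IsStrictLocalMartingale Q 𝓕 X then 1 else 0

open Classical in
/-- The region of maturities and strikes: small strikes if `α < 1`, large strikes if `α = 1`. -/
noncomputable def observationRegion (α δ C : ℝ) : Set (ℝ × ℝ) :=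
  if α < 1 then Set.Ici 0 ×ˢ Set.Ioc 0 δ else Set.Ici 0 ×ˢ Set.Ici C

/-! ### Neural networks -/

/-- `IsHiddenPart ς n ℓ m h`: the map `h : ℝⁿ → ℝᵐ` is a composition
`(ς ∘ W_ℓ) ∘ ⋯ ∘ (ς ∘ W_1)` with affine maps `W_i` and `ς` acting componentwise. -/
inductive IsHiddenPart (ς : ℝ → ℝ) (n : ℕ) :
    (ℓ m : ℕ) → ((Fin n → ℝ) → (Fin m → ℝ)) → Prop
  | input : IsHiddenPart ς n 0 n id
  | layer {ℓ m k : ℕ} {h : (Fin n → ℝ) → (Fin m → ℝ)} (hh : IsHiddenPart ς n ℓ m h)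
      (hk : 1 ≤ k) (A : (Fin m → ℝ) →ᵃ[ℝ] (Fin k → ℝ)) :
      IsHiddenPart ς n (ℓ + 1) k (fun x i => ς (A (h x) i))

/-- Neural networks `ψ ∘ W_L ∘ (ς ∘ W_{L-1}) ∘ ⋯ ∘ (ς ∘ W_1)` on `ℝⁿ` with `L` affine maps,
inner activation `ς` and outer activation `ψ`. -/
def IsNeuralNetwork (ς ψ : ℝ → ℝ) (L n : ℕ) (G : (Fin n → ℝ) → ℝ) : Prop :=
  2 ≤ L ∧ ∃ (m : ℕ) (h : (Fin n → ℝ) → (Fin m → ℝ)) (A : (Fin m → ℝ) →ᵃ[ℝ] ℝ),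
    IsHiddenPart ς n (L - 1) m h ∧ ∀ x, G x = ψ (A (h x))

/-- Inner activations: bounded, continuous and non-constant. -/
structure IsInnerActivation (ς : ℝ → ℝ) : Prop where
  bounded : ∃ B : ℝ, ∀ x, |ς x| ≤ B
  continuous : Continuous ς
  nonconstant : ∃ x y, ς x ≠ ς y

/-- Outer activations for networks with values in `[0,1]`: Lipschitz continuous and invertible.
A continuous map of the line cannot be a bijection onto the closed interval, so invertibility
is as a map onto the open interval `(0,1)`. -/
structure IsOuterActivation (ψ : ℝ → ℝ) : Prop where
  lipschitz : ∃ C : ℝ≥0, LipschitzWith C ψ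
  bijOn : Set.BijOn ψ Set.univ (Set.Ioo 0 1)

/-! ### Universal approximation by shallow networks -/

section UniversalApproximation

open scoped ContDiff Convolution

/-! A bubble can be read off from expectations. A nonnegative local martingale is a supermartingale
by Fatou, so it is a martingale exactly when `E[X_N] = x₀` for all integers `N`. The call price
tends to `α x₀ + (1 - α) E[X_N]` as the strike tends to `0` and to `α (x₀ - E[X_N])` as it tends to
infinity; the first limit determines `E[X_N]` if `α < 1`, the second if `α = 1`. By density of the
observations and continuity of price surfaces, the indicator is therefore measurable with respect to
the σ-algebra of the countably many observed prices (`bubbleIndicator_eq`,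
`C12.measurable_eval_of_mem_closure`).

Lévy's upward theorem then approximates the indicator in `L¹` by Borel functions of finitely many
observations, and networks approximate these in `L¹` of the law of the observations
(`exists_isNeuralNetwork_comp_integral_lt`). Since all functions take values in `[0,1]`, `L¹`
closeness gives `Lᵖ` closeness.

Density of networks rests on `submodule_eq_top_of_comp_mem`: mollify the activation, differentiate
`f (s * v + b)` in `s` to obtain all powers of `v`, sum them to exponentials, and apply
Stone–Weierstrass. Depth is handled by induction on the number of hidden layers. -/

theorem Submodule.integral_mem_of_isClosed {E α : Type*} [NormedAddCommGroup E] [NormedSpace ℝ E]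
    [CompleteSpace E] [MeasurableSpace α] {μ : Measure α} (M : Submodule ℝ E)
    (hM : IsClosed (M : Set E)) {F : α → E} (hF : Integrable F μ) (h : ∀ a, F a ∈ M) :
    ∫ a, F a ∂μ ∈ M := by
  -- Since `M` is closed, `E ⧸ M` is a normed space; the continuous quotient map commutes with the
  -- integral and kills the integrand.
  rw [← Submodule.Quotient.mk_eq_zero, ← Submodule.mkQ_apply, ← Submodule.mkQL_apply,
    ← ContinuousLinearMap.integral_comp_comm _ hF]
  have : ∀ a, M.mkQL (F a) = 0 := fun a => by
    rw [Submodule.mkQL_apply, Submodule.mkQ_apply, Submodule.Quotient.mk_eq_zero]; exact h a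
  simp [this]

theorem Submodule.hasDerivAt_mem_of_isClosed {E : Type*} [NormedAddCommGroup E] [NormedSpace ℝ E]
    (M : Submodule ℝ E) (hM : IsClosed (M : Set E)) {F : ℝ → E} {F' : E} {s : ℝ}
    (hF : HasDerivAt F F' s) (h : ∀ a, F a ∈ M) : F' ∈ M := by
  rw [← Submodule.Quotient.mk_eq_zero, ← Submodule.mkQ_apply, ← Submodule.mkQL_apply]
  have h0 : (fun a => M.mkQL (F a)) = fun _ => 0 := funext fun a => by
    rw [Submodule.mkQL_apply, Submodule.mkQ_apply, Submodule.Quotient.mk_eq_zero]; exact h a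
  have h1 : HasDerivAt (fun a => M.mkQL (F a)) (M.mkQL F') s :=
    M.mkQL.hasFDerivAt.comp_hasDerivAt s hF
  rw [h0] at h1
  exact h1.unique (hasDerivAt_const s 0)

theorem Polynomial.exists_derivative_eq (P : Polynomial ℝ) :
    ∃ R : Polynomial ℝ, R.derivative = P := by
  induction P using Polynomial.induction_on' with
  | add p q hp hq =>
    obtain ⟨a, rfl⟩ := hp
    obtain ⟨b, rfl⟩ := hq
    exact ⟨a + b, by simp⟩
  | monomial n a =>
    refine ⟨Polynomial.monomial (n + 1) (a / (n + 1)), ?_⟩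
    rw [Polynomial.derivative_monomial]
    have : (n : ℝ) + 1 ≠ 0 := by positivity
    congr 1
    push_cast
    field_simp

theorem exists_polynomial_of_iteratedDeriv_eq_zero (k : ℕ) (f : ℝ → ℝ) (hf : ContDiff ℝ ∞ f)
    (h : ∀ x, iteratedDeriv k f x = 0) : ∃ P : Polynomial ℝ, ∀ x, f x = P.eval x := by
  induction k generalizing f with
  | zero => exact ⟨0, fun x => by simpa using h x⟩
  | succ k ih =>
    have hd : ContDiff ℝ ∞ (deriv f) := by
      have := contDiff_infty_iff_deriv.1 hf
      exact this.2
    obtain ⟨P, hP⟩ := ih (deriv f) hd (fun x => by rw [← iteratedDeriv_succ']; exact h x)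
    obtain ⟨R, rfl⟩ := P.exists_derivative_eq
    have hdf : Differentiable ℝ f := hf.differentiable (by simp)
    have h0 : ∀ x, HasDerivAt (fun y => f y - R.eval y) 0 x := fun x => by
      have := (hdf x).hasDerivAt.sub (R.hasDerivAt x)
      rw [hP x, sub_self] at this
      exact this
    refine ⟨R + Polynomial.C (f 0 - R.eval 0), fun x => ?_⟩
    have := is_const_of_deriv_eq_zero (fun x => (h0 x).differentiableAt)
      (fun x => (h0 x).deriv) x 0
    simp only [Polynomial.eval_add, Polynomial.eval_C]
    linarith

/-- If some derivative vanished identically, `f` would be a polynomial, and a bounded polynomial is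
constant. -/
theorem exists_iteratedDeriv_ne_zero {f : ℝ → ℝ} (hf : ContDiff ℝ ∞ f) {B : ℝ}
    (hB : ∀ x, |f x| ≤ B) (hne : ∃ x y, f x ≠ f y) (k : ℕ) : ∃ x, iteratedDeriv k f x ≠ 0 := by
  by_contra! h
  obtain ⟨P, hP⟩ := exists_polynomial_of_iteratedDeriv_eq_zero k f hf h
  obtain ⟨x, y, hxy⟩ := hne
  by_cases hdeg : 0 < P.degree
  · obtain ⟨z, hz⟩ := ((P.abs_tendsto_atTop hdeg).eventually_gt_atTop B).exists
    exact absurd (hB z) (by rw [hP z]; exact not_le.2 hz)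
  · rw [Polynomial.eq_C_of_degree_le_zero (not_lt.1 hdeg)] at hP
    exact hxy (by simp [hP])

/-- Mollifications converge pointwise to `ς` as the bump shrinks; if all of them were constant, so
would be `ς`. -/
theorem exists_contDiffBump_convolution_ne {ς : ℝ → ℝ} (hς : IsInnerActivation ς) :
    ∃ φ : ContDiffBump (0 : ℝ), ∃ x y,
      (φ.normed volume ⋆[ContinuousLinearMap.lsmul ℝ ℝ, volume] ς) x ≠
      (φ.normed volume ⋆[ContinuousLinearMap.lsmul ℝ ℝ, volume] ς) y := by
  by_contra! h
  obtain ⟨x, y, hxy⟩ := hς.nonconstant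
  let φ : ℕ → ContDiffBump (0 : ℝ) := fun n =>
    ⟨1 / (n + 1 : ℝ) / 2, 1 / (n + 1 : ℝ), by positivity, half_lt_self (by positivity)⟩
  have hφ : Tendsto (fun n => (φ n).rOut) atTop (𝓝 0) := tendsto_one_div_add_atTop_nhds_zero_nat
  have hx := ContDiffBump.convolution_tendsto_right_of_continuous (μ := volume) hφ hς.continuous x
  have hy := ContDiffBump.convolution_tendsto_right_of_continuous (μ := volume) hφ hς.continuous y
  exact hxy (tendsto_nhds_unique (hx.congr fun n => h (φ n) x y) hy)

variable {X : Type*} [TopologicalSpace X]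

/-- The function `v ^ k * f^{(k)} (s * v + b)`, the `k`-th derivative in `s` of `f (s * v + b)`. -/
noncomputable def ridgeDeriv (f : ℝ → ℝ) (hf : ContDiff ℝ ∞ f) (v : C(X, ℝ)) (b : ℝ) (k : ℕ)
    (s : ℝ) : C(X, ℝ) :=
  v ^ k * (⟨iteratedDeriv k f, hf.continuous_iteratedDeriv k (mod_cast le_top)⟩ : C(ℝ, ℝ)).comp
    (s • v + ContinuousMap.const X b)

theorem ridgeDeriv_apply (f : ℝ → ℝ) (hf : ContDiff ℝ ∞ f) (v : C(X, ℝ)) (b : ℝ) (k : ℕ)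
    (s : ℝ) (x : X) :
    ridgeDeriv f hf v b k s x = v x ^ k * iteratedDeriv k f (s * v x + b) := by
  simp [ridgeDeriv]

theorem continuous_ridgeDeriv (f : ℝ → ℝ) (hf : ContDiff ℝ ∞ f) (v : C(X, ℝ)) (b : ℝ) (k : ℕ) :
    Continuous (ridgeDeriv f hf v b k) := by
  refine ContinuousMap.continuous_of_continuous_uncurry _ ?_
  have h : Continuous (iteratedDeriv k f) := hf.continuous_iteratedDeriv k (mod_cast le_top)
  have : Function.uncurry (fun s x => ridgeDeriv f hf v b k s x) =
      fun p : ℝ × X => v p.2 ^ k * iteratedDeriv k f (p.1 * v p.2 + b) := by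
    ext p; exact ridgeDeriv_apply f hf v b k p.1 p.2
  rw [this]
  fun_prop

/-- The derivative is taken in the sup norm. Pointwise differentiation only gives the integral
identity `h1` after evaluation at each `x`; the fundamental theorem of calculus for the continuous
`C(X, ℝ)`-valued integrand then upgrades it. -/
theorem hasDerivAt_ridgeDeriv [CompactSpace X] (f : ℝ → ℝ) (hf : ContDiff ℝ ∞ f) (v : C(X, ℝ)) (b : ℝ) (k : ℕ)
    (s : ℝ) : HasDerivAt (ridgeDeriv f hf v b k) (ridgeDeriv f hf v b (k + 1) s) s := by
  have hc := continuous_ridgeDeriv f hf v b (k + 1)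
  have h1 : ∀ s, ridgeDeriv f hf v b k s =
      ridgeDeriv f hf v b k 0 + ∫ u in (0 : ℝ)..s, ridgeDeriv f hf v b (k + 1) u := fun s => by
    ext x
    have h2 : (∫ u in (0 : ℝ)..s, ridgeDeriv f hf v b (k + 1) u) x =
        ∫ u in (0 : ℝ)..s, ridgeDeriv f hf v b (k + 1) u x :=
      ((ContinuousMap.evalCLM ℝ x).intervalIntegral_comp_comm (hc.intervalIntegrable 0 s)).symm
    rw [ContinuousMap.add_apply, h2]
    have h3 : ∀ u, HasDerivAt (fun u => ridgeDeriv f hf v b k u x)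
        (ridgeDeriv f hf v b (k + 1) u x) u := fun u => by
      simp only [ridgeDeriv_apply]
      have h4 : HasDerivAt (iteratedDeriv k f) (iteratedDeriv (k + 1) f (u * v x + b))
          (u * v x + b) := by
        rw [iteratedDeriv_succ]
        exact ((hf.differentiable_iteratedDeriv k (mod_cast ENat.natCast_lt_top k)) _).hasDerivAt
      have h5 : HasDerivAt (fun u => u * v x + b) (v x) u := by
        simpa using ((hasDerivAt_id u).mul_const (v x)).add_const b
      have := (h4.comp u h5).const_mul (v x ^ k)
      rw [pow_succ, mul_assoc, mul_comm (v x)]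
      exact this
    rw [intervalIntegral.integral_eq_sub_of_hasDerivAt (fun u _ => h3 u)]
    · exact (add_sub_cancel _ _).symm
    · exact ((ContinuousMap.evalCLM ℝ x).continuous.comp hc).intervalIntegrable 0 s
  rw [funext h1]
  exact (intervalIntegral.integral_hasDerivAt_right (hc.intervalIntegrable 0 s)
    hc.aestronglyMeasurable.stronglyMeasurableAtFilter hc.continuousAt).const_add _

/-- A closed subspace containing all `ς ∘ v`, for `v` in a point-separating space of functions,
is everything: shallow networks are dense. -/
theorem submodule_eq_top_of_comp_mem [CompactSpace X] {ς : ℝ → ℝ} (hς : IsInnerActivation ς)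
    (V : Submodule ℝ C(X, ℝ)) (hone : 1 ∈ V)
    (hsep : ∀ x y : X, x ≠ y → ∃ v ∈ V, v x ≠ v y) (M : Submodule ℝ C(X, ℝ))
    (hM : IsClosed (M : Set C(X, ℝ)))
    (hVM : ∀ v ∈ V, (⟨ς, hς.continuous⟩ : C(ℝ, ℝ)).comp v ∈ M) : M = ⊤ := by
  obtain ⟨φ, hφ⟩ := exists_contDiffBump_convolution_ne hς
  obtain ⟨B, hB⟩ := hς.bounded
  set f := φ.normed volume ⋆[ContinuousLinearMap.lsmul ℝ ℝ, volume] ς with hfdef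
  have hf : ContDiff ℝ ∞ f :=
    φ.hasCompactSupport_normed.contDiff_convolution_left (μ := volume)
      (ContinuousLinearMap.lsmul ℝ ℝ) φ.contDiff_normed hς.continuous.locallyIntegrable
  have hfx : ∀ x, f x = ∫ y, φ.normed volume y * ς (x - y) := fun x => by
    simp [hfdef, convolution_def]
  have hfB : ∀ x, |f x| ≤ B := fun x => by
    rw [hfx]
    calc |∫ y, φ.normed volume y * ς (x - y)| ≤ ∫ y, φ.normed volume y * B := by
          have hi : Integrable (φ.normed volume) := φ.integrable_normed
          rw [← Real.norm_eq_abs]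
          refine norm_integral_le_of_norm_le (hi.mul_const B) (ae_of_all _ fun y => ?_)
          rw [norm_mul, Real.norm_of_nonneg (φ.nonneg_normed y)]
          exact mul_le_mul_of_nonneg_left (hB _) (φ.nonneg_normed y)
      _ = B := by rw [integral_mul_const, φ.integral_normed, one_mul]
  have hconst : ∀ b : ℝ, ContinuousMap.const X b ∈ V := fun b => by
    have := V.smul_mem b hone
    convert this using 1
    ext; simp
  -- `f ∘ v` is the integral over `y` of `ς ∘ (v - y)` weighted by the bump, and `v - y` stays in
  -- `V` because constants do.
  have hfM : ∀ v ∈ V, (⟨f, hf.continuous⟩ : C(ℝ, ℝ)).comp v ∈ M := fun v hv => by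
    let F : ℝ → C(X, ℝ) := fun y => φ.normed volume y •
      (⟨ς, hς.continuous⟩ : C(ℝ, ℝ)).comp (v - ContinuousMap.const X y)
    have hFc : Continuous F := by
      refine φ.continuous_normed.smul (ContinuousMap.continuous_of_continuous_uncurry _ ?_)
      change Continuous fun p : ℝ × X => ς (v p.2 - p.1)
      have := hς.continuous
      fun_prop
    have hFi : Integrable F :=
      hFc.integrable_of_hasCompactSupport (φ.hasCompactSupport_normed.smul_right)
    have := M.integral_mem_of_isClosed hM hFi
      (fun y => M.smul_mem _ (hVM _ (V.sub_mem hv (hconst y))))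
    convert this using 1
    ext x
    have h2 : (∫ y, F y) x = ∫ y, F y x :=
      ((ContinuousMap.evalCLM ℝ x).integral_comp_comm hFi).symm
    rw [h2]
    exact hfx (v x)
  have hridge : ∀ v ∈ V, ∀ b k s, ridgeDeriv f hf v b k s ∈ M := fun v hv b k => by
    induction k with
    | zero =>
      intro s
      have := hfM _ (V.add_mem (V.smul_mem s hv) (hconst b))
      convert this using 1
      ext x
      simp [ridgeDeriv_apply]
    | succ k ih =>
      exact fun s => M.hasDerivAt_mem_of_isClosed hM (hasDerivAt_ridgeDeriv f hf v b k s) ih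
  -- At `s = 0` the ridge derivative is `v ^ k` times the number `f^{(k)}(b)`, and `b` is chosen to
  -- make this number nonzero.
  have hpow : ∀ v ∈ V, ∀ k : ℕ, v ^ k ∈ M := fun v hv k => by
    obtain ⟨b, hb⟩ := exists_iteratedDeriv_ne_zero hf hfB hφ k
    have := M.smul_mem (iteratedDeriv k f b)⁻¹ (hridge v hv b k 0)
    convert this using 1
    ext x
    simp only [ContinuousMap.pow_apply, ContinuousMap.smul_apply, ridgeDeriv_apply, zero_mul,
      zero_add, smul_eq_mul]
    field_simp
  have hexp : ∀ v ∈ V, NormedSpace.exp v ∈ M := fun v hv =>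
    hM.mem_of_tendsto (NormedSpace.exp_series_hasSum_exp' (𝕂 := ℝ) v)
      (Eventually.of_forall fun s => M.sum_mem fun k _ => M.smul_mem _ (hpow v hv k))
  -- `V` is only closed under sums, but its exponentials are closed under products, so their linear
  -- span is already an algebra.
  let S : Submonoid C(X, ℝ) :=
    { carrier := {u | ∃ v ∈ V, u = NormedSpace.exp v}
      one_mem' := ⟨0, V.zero_mem, NormedSpace.exp_zero.symm⟩
      mul_mem' := by
        rintro _ _ ⟨v, hv, rfl⟩ ⟨w, hw, rfl⟩
        exact ⟨v + w, V.add_mem hv hw, (NormedSpace.exp_add_of_commute (Commute.all v w)).symm⟩ }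
  have hSM : Subalgebra.toSubmodule (Algebra.adjoin ℝ (S : Set C(X, ℝ))) ≤ M := by
    rw [Algebra.adjoin_eq_span, Submonoid.closure_eq, Submodule.span_le]
    rintro _ ⟨v, hv, rfl⟩
    exact hexp v hv
  have hdense := ContinuousMap.subalgebra_topologicalClosure_eq_top_of_separatesPoints
    (Algebra.adjoin ℝ (S : Set C(X, ℝ))) (by
      intro x y hxy
      obtain ⟨v, hv, hne⟩ := hsep x y hxy
      refine ⟨_, ⟨NormedSpace.exp v, Algebra.subset_adjoin ⟨v, hv, rfl⟩, rfl⟩, ?_⟩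
      have he : ∀ z, NormedSpace.exp v z = Real.exp (v z) := fun z => by
        have := NormedSpace.map_exp (ContinuousMap.evalAlgHom ℝ ℝ z)
          (ContinuousMap.evalCLM ℝ z).continuous v
        rw [Real.exp_eq_exp_ℝ]
        exact this
      change NormedSpace.exp v x ≠ NormedSpace.exp v y
      rw [he, he]
      exact fun h => hne (Real.exp_injective h))
  refine eq_top_iff.2 fun u _ => ?_
  have hu : u ∈ (Algebra.adjoin ℝ (S : Set C(X, ℝ))).topologicalClosure := hdense ▸ trivial
  exact closure_minimal hSM hM hu

end UniversalApproximation

/-! ### Deep networks -/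

section DeepNetworks

variable {ς ψ : ℝ → ℝ} {n : ℕ}

theorem IsHiddenPart.continuous (hς : Continuous ς) {ℓ m : ℕ} {h : (Fin n → ℝ) → (Fin m → ℝ)}
    (hh : IsHiddenPart ς n ℓ m h) : Continuous h := by
  induction hh with
  | input => exact continuous_id
  | layer _ _ A ih =>
    exact continuous_pi fun i =>
      hς.comp ((continuous_apply i).comp (A.continuous_of_finiteDimensional.comp ih))

theorem exists_isHiddenPart (ς : ℝ → ℝ) (n ℓ : ℕ) :
    ∃ (m : ℕ) (h : (Fin n → ℝ) → (Fin m → ℝ)), IsHiddenPart ς n ℓ m h := by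
  induction ℓ with
  | zero => exact ⟨n, id, .input⟩
  | succ ℓ ih =>
    obtain ⟨m, h, hh⟩ := ih
    exact ⟨1, _, .layer hh le_rfl 0⟩

/-- Two hidden parts of the same depth are affine images of a single one. -/
theorem IsHiddenPart.exists_common {ℓ m m' : ℕ} {h : (Fin n → ℝ) → (Fin m → ℝ)}
    {h' : (Fin n → ℝ) → (Fin m' → ℝ)} (hh : IsHiddenPart ς n ℓ m h)
    (hh' : IsHiddenPart ς n ℓ m' h') :
    ∃ (k : ℕ) (g : (Fin n → ℝ) → (Fin k → ℝ)) (B : (Fin k → ℝ) →ᵃ[ℝ] (Fin m → ℝ))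
      (B' : (Fin k → ℝ) →ᵃ[ℝ] (Fin m' → ℝ)), IsHiddenPart ς n ℓ k g ∧
      (∀ x, h x = B (g x)) ∧ ∀ x, h' x = B' (g x) := by
  induction hh generalizing m' with
  | input =>
    cases hh'
    exact ⟨n, id, AffineMap.id ℝ _, AffineMap.id ℝ _, .input, fun _ => rfl, fun _ => rfl⟩
  | @layer ℓ m₁ k₁ h₁ hh₁ hk₁ A₁ ih =>
    cases hh' with
    | @layer _ m₂ _ h₂ hh₂ hk₂ A₂ =>
      obtain ⟨k, g, B, B', hg, hB, hB'⟩ := ih hh₂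
      -- The two last layers are stacked side by side over the common previous layer; the affine
      -- maps `B`, `B'` of the induction hypothesis are absorbed into the weights.
      let D : Fin (k₁ + m') → ((Fin k → ℝ) →ᵃ[ℝ] ℝ) :=
        Fin.addCases (fun i => (AffineMap.proj i).comp (A₁.comp B))
          (fun i => (AffineMap.proj i).comp (A₂.comp B'))
      refine ⟨k₁ + m', _, (LinearMap.funLeft ℝ ℝ (Fin.castAdd m')).toAffineMap,
        (LinearMap.funLeft ℝ ℝ (Fin.natAdd k₁)).toAffineMap,
        .layer hg (by omega) (AffineMap.pi D), fun x => ?_, fun x => ?_⟩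
      · ext i
        simp [D, LinearMap.funLeft_apply, hB]
      · ext i
        simp [D, LinearMap.funLeft_apply, hB']

/-- The functions on `K` that are affine in the last hidden layer of a network with `ℓ` hidden
layers. -/
def networkSpace (ς : ℝ → ℝ) (n ℓ : ℕ) (K : Set (Fin n → ℝ)) : Submodule ℝ C(K, ℝ) where
  carrier := {u | ∃ (m : ℕ) (h : (Fin n → ℝ) → (Fin m → ℝ)) (A : (Fin m → ℝ) →ᵃ[ℝ] ℝ),
    IsHiddenPart ς n ℓ m h ∧ ∀ x : K, u x = A (h x)}
  add_mem' := by
    rintro u u' ⟨m, h, A, hh, hu⟩ ⟨m', h', A', hh', hu'⟩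
    obtain ⟨k, g, B, B', hg, hB, hB'⟩ := hh.exists_common hh'
    exact ⟨k, g, A.comp B + A'.comp B', hg, fun x => by simp [hu, hu', hB, hB']⟩
  zero_mem' := by
    obtain ⟨m, h, hh⟩ := exists_isHiddenPart ς n ℓ
    exact ⟨m, h, 0, hh, fun x => by simp⟩
  smul_mem' := by
    rintro c u ⟨m, h, A, hh, hu⟩
    exact ⟨m, h, c • A, hh, fun x => by simp [hu]⟩

variable {K : Set (Fin n → ℝ)}

theorem one_mem_networkSpace (ℓ : ℕ) : 1 ∈ networkSpace ς n ℓ K := by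
  obtain ⟨m, h, hh⟩ := exists_isHiddenPart ς n ℓ
  exact ⟨m, h, AffineMap.const ℝ _ 1, hh, fun x => by simp⟩

theorem comp_mem_networkSpace (hς : Continuous ς) {ℓ : ℕ} {v : C(K, ℝ)}
    (hv : v ∈ networkSpace ς n ℓ K) :
    (⟨ς, hς⟩ : C(ℝ, ℝ)).comp v ∈ networkSpace ς n (ℓ + 1) K := by
  obtain ⟨m, h, A, hh, hu⟩ := hv
  exact ⟨1, _, AffineMap.proj 0, .layer hh le_rfl (AffineMap.pi fun _ => A), fun x => by simp [hu]⟩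

/-- If one more layer failed to separate `x` and `y`, the closed subspace `u x = u y` would contain
`ς ∘ v` for all `v` of the previous depth. By the density theorem it would be everything, yet some
coordinate distinguishes `x` from `y`. -/
theorem networkSpace_separatesPoints (hς : IsInnerActivation ς) [CompactSpace K] (ℓ : ℕ) :
    ∀ x y : K, x ≠ y → ∃ v ∈ networkSpace ς n ℓ K, v x ≠ v y := by
  induction ℓ with
  | zero =>
    intro x y hxy
    obtain ⟨i, hi⟩ := Function.ne_iff.1 (fun h => hxy (Subtype.ext h) : (x : Fin n → ℝ) ≠ y)
    exact ⟨⟨fun z => (z : Fin n → ℝ) i, (continuous_apply i).comp continuous_subtype_val⟩, ⟨n, id, AffineMap.proj i, .input,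
      fun z => by simp⟩, hi⟩
  | succ ℓ ih =>
    intro x y hxy
    by_contra! hcon
    let M : Submodule ℝ C(K, ℝ) :=
      LinearMap.ker ((ContinuousMap.evalCLM ℝ x - ContinuousMap.evalCLM ℝ y : C(K, ℝ) →L[ℝ] ℝ) :
        C(K, ℝ) →ₗ[ℝ] ℝ)
    have hM : ∀ u, u ∈ M ↔ u x = u y := fun u => by
      simp [M, sub_eq_zero, ContinuousMap.evalCLM]
    have htop : M = ⊤ := submodule_eq_top_of_comp_mem hς _ (one_mem_networkSpace ℓ) ih M
      (ContinuousLinearMap.isClosed_ker _)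
      (fun v hv => (hM _).2 (hcon _ (comp_mem_networkSpace hς.continuous hv)))
    obtain ⟨i, hi⟩ := Function.ne_iff.1 (fun h => hxy (Subtype.ext h) : (x : Fin n → ℝ) ≠ y)
    have : (⟨fun z => (z : Fin n → ℝ) i, (continuous_apply i).comp continuous_subtype_val⟩ : C(K, ℝ)) ∈ M := htop ▸ trivial
    exact hi ((hM _).1 this)

theorem topologicalClosure_networkSpace (hς : IsInnerActivation ς) [CompactSpace K] (ℓ : ℕ) :
    (networkSpace ς n (ℓ + 1) K).topologicalClosure = ⊤ :=
  submodule_eq_top_of_comp_mem hς _ (one_mem_networkSpace ℓ) (networkSpace_separatesPoints hς ℓ) _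
    (Submodule.isClosed_topologicalClosure _)
    (fun _ hv => Submodule.le_topologicalClosure _ (comp_mem_networkSpace hς.continuous hv))

theorem exists_isHiddenPart_abs_sub_lt (hς : IsInnerActivation ς) (hK : IsCompact K) (ℓ : ℕ)
    {u : (Fin n → ℝ) → ℝ} (hu : Continuous u) {η : ℝ} (hη : 0 < η) :
    ∃ (m : ℕ) (h : (Fin n → ℝ) → (Fin m → ℝ)) (A : (Fin m → ℝ) →ᵃ[ℝ] ℝ),
      IsHiddenPart ς n (ℓ + 1) m h ∧ ∀ x ∈ K, |A (h x) - u x| < η := by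
  have : CompactSpace K := isCompact_iff_compactSpace.1 hK
  let w₀ : C(K, ℝ) := ⟨fun x => u x, hu.comp continuous_subtype_val⟩
  have hmem : w₀ ∈ (networkSpace ς n (ℓ + 1) K).topologicalClosure :=
    (topologicalClosure_networkSpace (K := K) hς ℓ).symm ▸ trivial
  obtain ⟨w, ⟨m, h, A, hh, hw⟩, hd⟩ := Metric.mem_closure_iff.1 hmem η hη
  refine ⟨m, h, A, hh, fun x hx => ?_⟩
  have := (ContinuousMap.dist_apply_le_dist (f := w₀) (g := w) ⟨x, hx⟩).trans_lt hd
  rw [hw, dist_comm] at this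
  exact this

theorem IsOuterActivation.continuous (hψ : IsOuterActivation ψ) : Continuous ψ :=
  hψ.lipschitz.choose_spec.continuous

/-- A continuous injection of the line is strictly monotone, and an order-connected range makes it
an embedding; reflection reduces the decreasing case to the increasing one. The continuous inverse
serves to pull targets back through `ψ`. -/
theorem IsOuterActivation.isEmbedding (hψ : IsOuterActivation ψ) : IsEmbedding ψ := by
  have hinj : Function.Injective ψ := Set.injOn_univ.1 hψ.bijOn.injOn
  have hrange : Set.range ψ = Set.Ioo 0 1 := by rw [← Set.image_univ, hψ.bijOn.image_eq]
  rcases hψ.continuous.strictMono_of_inj hinj with h | h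
  · exact h.isEmbedding_of_ordConnected (hrange ▸ Set.ordConnected_Ioo)
  · have h2 : StrictMono (fun x => ψ (-x)) := fun a b hab => h (neg_lt_neg hab)
    have h3 : Set.range (fun x => ψ (-x)) = Set.Ioo 0 1 := by
      rw [← hrange]
      exact (Equiv.neg ℝ).surjective.range_comp ψ
    have := (h2.isEmbedding_of_ordConnected (h3 ▸ Set.ordConnected_Ioo)).comp
      (Homeomorph.neg ℝ).isEmbedding
    convert this using 1
    ext x
    simp

theorem IsOuterActivation.exists_continuous_comp_eq (hψ : IsOuterActivation ψ) {X : Type*}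
    [TopologicalSpace X] {g : X → ℝ} (hg : Continuous g) (h : ∀ x, g x ∈ Set.Ioo (0 : ℝ) 1) :
    ∃ u : X → ℝ, Continuous u ∧ ∀ x, ψ (u x) = g x := by
  choose u _ hu using fun x => hψ.bijOn.surjOn (h x)
  refine ⟨u, hψ.isEmbedding.continuous_iff.2 ?_, hu⟩
  exact hg.congr fun x => (hu x).symm

theorem IsOuterActivation.mem_Ioo (hψ : IsOuterActivation ψ) (x : ℝ) : ψ x ∈ Set.Ioo (0 : ℝ) 1 :=
  hψ.bijOn.mapsTo (Set.mem_univ x)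

/-- Networks approximate `[0, 1]`-valued measurable functions in mean. -/
theorem exists_isNeuralNetwork_integral_lt (hς : IsInnerActivation ς) (hψ : IsOuterActivation ψ)
    {L : ℕ} (hL : 2 ≤ L) (P : Measure (Fin n → ℝ)) [IsProbabilityMeasure P]
    {f : (Fin n → ℝ) → ℝ} (hf : Measurable f) (hf01 : ∀ x, f x ∈ Set.Icc (0 : ℝ) 1)
    {ε : ℝ} (hε : 0 < ε) :
    ∃ G : (Fin n → ℝ) → ℝ, IsNeuralNetwork ς ψ L n G ∧ Continuous G ∧
      (∀ x, G x ∈ Set.Icc (0 : ℝ) 1) ∧ ∫ x, |G x - f x| ∂P < ε := by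
  have hfi : Integrable f P := by
    refine Integrable.of_bound hf.aestronglyMeasurable 1 (ae_of_all _ fun x => ?_)
    rw [Real.norm_of_nonneg (hf01 x).1]
    exact (hf01 x).2
  -- Four errors of size at most `η` occur: the `L¹` approximation by `g₀`, its clamping to `[η, 1 -
  -- η]`, the network error on `K`, and the mass outside `K`. The bound `1 / 4` keeps the clamping
  -- interval nonempty and inside `(0,1)`.
  set η := min (ε / 5) (1 / 4) with hη
  have hη0 : 0 < η := by positivity
  have hηε : η ≤ ε / 5 := min_le_left _ _
  have hη4 : η ≤ 1 / 4 := min_le_right _ _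
  obtain ⟨g₀, hg₀, hg₀i⟩ := hfi.exists_boundedContinuous_integral_sub_le hη0
  let g : (Fin n → ℝ) → ℝ := fun x => max η (min (1 - η) (g₀ x))
  have hgc : Continuous g := by fun_prop
  have hg01 : ∀ x, g x ∈ Set.Ioo (0 : ℝ) 1 := fun x =>
    ⟨hη0.trans_le (le_max_left _ _), max_lt (by linarith) ((min_le_left _ _).trans_lt (by linarith))⟩
  have hgf : ∀ x, |g x - f x| ≤ ‖f x - g₀ x‖ + η := fun x => by
    obtain ⟨h0, h1⟩ := hf01 x
    rw [Real.norm_eq_abs]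
    have h2 := le_abs_self (f x - g₀ x)
    have h3 := neg_abs_le (f x - g₀ x)
    rw [abs_le]
    constructor
    · have : min (f x - |f x - g₀ x| - η) (1 - η) ≤ g x :=
        le_trans (le_min (min_le_right _ _) ((min_le_left _ _).trans (by linarith)))
          (le_max_right _ _)
      rcases min_le_iff.1 this with h | h <;> [linarith; linarith [abs_nonneg (f x - g₀ x)]]
    · have : g x ≤ f x + |f x - g₀ x| + η :=
        max_le (by linarith [abs_nonneg (f x - g₀ x)]) ((min_le_right _ _).trans (by linarith))
      linarith
  obtain ⟨u, huc, hu⟩ := hψ.exists_continuous_comp_eq hgc hg01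
  obtain ⟨K, -, hK, hPK⟩ := MeasurableSet.univ.exists_isCompact_sdiff_lt (μ := P)
    (measure_ne_top P _) (ENNReal.ofReal_pos.2 hη0).ne'
  have hPK' : P.real Kᶜ ≤ η := by
    rw [← Set.compl_eq_univ_sdiff] at hPK
    exact ENNReal.toReal_le_of_le_ofReal hη0.le hPK.le
  obtain ⟨c, hc⟩ := hψ.lipschitz
  -- The precision is divided by `c + 1` rather than by the Lipschitz constant `c` of `ψ`, which is
  -- not known to be positive here.
  obtain ⟨m, h, A, hh, hA⟩ := exists_isHiddenPart_abs_sub_lt hς hK (L - 2) huc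
    (show 0 < η / (c + 1) by positivity)
  have hGc : Continuous fun x => ψ (A (h x)) :=
    hψ.continuous.comp (A.continuous_of_finiteDimensional.comp (hh.continuous hς.continuous))
  have hGm : ∀ x, ψ (A (h x)) ∈ Set.Icc (0 : ℝ) 1 := fun x =>
    Set.Ioo_subset_Icc_self (hψ.mem_Ioo _)
  refine ⟨fun x => ψ (A (h x)), ⟨hL, m, h, A, ?_, fun x => rfl⟩, hGc, hGm, ?_⟩
  · rwa [show L - 1 = L - 2 + 1 by omega]
  have hpt : ∀ x, |ψ (A (h x)) - f x| ≤
      η + Kᶜ.indicator (fun _ => (1 : ℝ)) x + (‖f x - g₀ x‖ + η) := fun x => by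
    refine (abs_sub_le _ (g x) _).trans (add_le_add ?_ (hgf x))
    by_cases hx : x ∈ K
    · have h1 := hc.dist_le_mul (A (h x)) (u x)
      rw [hu, Real.dist_eq, Real.dist_eq] at h1
      have h2 : (c : ℝ) * |A (h x) - u x| ≤ (c + 1) * (η / (c + 1)) :=
        mul_le_mul (by linarith) (hA x hx).le (abs_nonneg _) (by positivity)
      rw [mul_div_cancel₀ _ (by positivity)] at h2
      simpa [hx] using h1.trans h2
    · have h1 := hg01 x
      have h2 := hGm x
      simp only [Set.mem_compl_iff, hx, not_false_eq_true, Set.indicator_of_mem]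
      rw [abs_le]
      constructor <;> linarith [h1.1, h1.2, h2.1, h2.2]
  have hKm : MeasurableSet Kᶜ := hK.isClosed.measurableSet.compl
  have hi1 : Integrable (Kᶜ.indicator (fun _ => (1 : ℝ))) P :=
    (integrable_const 1).indicator hKm
  have hi2 : Integrable (fun x => ‖f x - g₀ x‖) P := (hfi.sub hg₀i).norm
  have hbound : Integrable (fun x => η + Kᶜ.indicator (fun _ => (1 : ℝ)) x +
      (‖f x - g₀ x‖ + η)) P :=
    ((integrable_const η).add hi1).add (hi2.add (integrable_const η))
  calc ∫ x, |ψ (A (h x)) - f x| ∂P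
      ≤ ∫ x, (η + Kᶜ.indicator (fun _ => (1 : ℝ)) x + (‖f x - g₀ x‖ + η)) ∂P :=
        integral_mono_of_nonneg (ae_of_all _ fun x => abs_nonneg _) hbound (ae_of_all _ hpt)
    _ = (η + P.real Kᶜ) + (∫ x, ‖f x - g₀ x‖ ∂P + η) := by
        rw [integral_add (f := fun x => η + Kᶜ.indicator (fun _ => (1 : ℝ)) x)
            (g := fun x => ‖f x - g₀ x‖ + η) ((integrable_const η).add hi1)
            (hi2.add (integrable_const η)),
          integral_add (integrable_const η) hi1, integral_add hi2 (integrable_const η),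
          integral_indicator_const _ hKm]
        simp
    _ < ε := by linarith

end DeepNetworks

/-! ### Nonnegative local martingales -/

section LocalMartingale

variable {Ω : Type*} [mΩ : MeasurableSpace Ω] {Q : Measure Ω} [IsProbabilityMeasure Q]
  {𝓕 : Filtration ℝ≥0 mΩ} {M : ℝ≥0 → Ω → ℝ}

/-- Localization multiplies by the indicator of `⊥ < τ n`, so the constant becomes `c` times this
indicator: a time-independent `𝓕 ⊥`-measurable variable, hence a martingale. -/
theorem IsLocalMartingale.add_const (hM : IsLocalMartingale Q 𝓕 M) (c : ℝ) :
    IsLocalMartingale Q 𝓕 (fun t ω => M t ω + c) := by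
  obtain ⟨τ, hτ, h⟩ := hM
  refine ⟨τ, hτ, fun n => ?_⟩
  have hset : MeasurableSet[𝓕 ⊥] {ω | ⊥ < τ n ω} :=
    (hτ.isStoppingTime n).measurableSet_gt ⊥
  have hconst : Martingale (fun (_ : ℝ≥0) => {ω | ⊥ < τ n ω}.indicator (fun _ => c)) 𝓕 Q :=
    martingale_const_fun 𝓕 Q (stronglyMeasurable_const.indicator hset)
      ((integrable_const c).indicator (𝓕.le _ _ hset))
  have := (h n).add hconst
  convert this using 1
  ext t ω
  by_cases hω : ω ∈ {ω | ⊥ < τ n ω}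
  · simp only [stoppedProcess, Pi.add_apply, Set.indicator_of_mem hω]
  · simp only [stoppedProcess, Pi.add_apply, Set.indicator_of_notMem hω, add_zero]

/-- The supermartingale inequality by Fatou, stated with lower integrals since integrability of `M`
is only deduced from it. -/
theorem IsLocalMartingale.setLIntegral_mono (hM : IsLocalMartingale Q 𝓕 M)
    (hadap : StronglyAdapted 𝓕 M) (hnn : ∀ᵐ ω ∂Q, ∀ t, 0 ≤ M t ω) {s t : ℝ≥0} (hst : s ≤ t)
    {A : Set Ω} (hA : MeasurableSet[𝓕 s] A) :
    ∫⁻ ω in A, ENNReal.ofReal (M t ω) ∂Q ≤ ∫⁻ ω in A, ENNReal.ofReal (M s ω) ∂Q := by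
  obtain ⟨τ, hτ, h⟩ := hM
  set Y : ℕ → ℝ≥0 → Ω → ℝ := fun n =>
    stoppedProcess (fun i => {ω | ⊥ < τ n ω}.indicator (M i)) (τ n) with hY
  have hYeq : ∀ n (r : ℝ≥0) ω, (r : WithTop ℝ≥0) < τ n ω → Y n r ω = M r ω := fun n r ω hr => by
    have h1 : ω ∈ {ω | ⊥ < τ n ω} := bot_le.trans_lt hr
    simp only [hY, stoppedProcess, Set.indicator_of_mem h1, min_eq_left hr.le]
    rfl
  have hYnn : ∀ᵐ ω ∂Q, ∀ n r, 0 ≤ Y n r ω := by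
    filter_upwards [hnn] with ω hω n r
    simp only [hY, stoppedProcess]
    exact Set.indicator_apply_nonneg fun _ => hω _
  have hMm : ∀ r, Measurable (M r) := fun r => ((hadap r).mono (𝓕.le r)).measurable
  have hYm : ∀ n r, Measurable (Y n r) := fun n r =>
    (((h n).stronglyAdapted r).mono (𝓕.le r)).measurable
  have hlt : ∀ᵐ ω ∂Q, ∀ r : ℝ≥0, ∀ᶠ n in atTop, (r : WithTop ℝ≥0) < τ n ω := by
    filter_upwards [hτ.tendsto_top] with ω hω r
    exact (WithTop.tendsto_nhds_top_iff _).1 hω r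
  have hAs : ∀ m, MeasurableSet[𝓕 s] (A ∩ {ω | (s : WithTop ℝ≥0) < τ m ω}) := fun m =>
    hA.inter ((hτ.isStoppingTime m).measurableSet_gt s)
  have hofReal : ∀ n r (B : Set Ω), ∫⁻ ω in B, ENNReal.ofReal (Y n r ω) ∂Q =
      ENNReal.ofReal (∫ ω in B, Y n r ω ∂Q) := fun n r B =>
    (ofReal_integral_eq_lintegral_ofReal ((h n).integrable r).integrableOn
      (ae_restrict_of_ae (hYnn.mono fun ω hω => hω n r))).symm
  -- On the event `s < τ m`, which lies in `𝓕 s`, the stopped processes agree at time `s` with `M`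
  -- for all `n ≥ m`, so only time `t` needs Fatou. A second application of Fatou lets `m` tend to
  -- infinity.
  have hm : ∀ m, ∫⁻ ω in A ∩ {ω | (s : WithTop ℝ≥0) < τ m ω}, ENNReal.ofReal (M t ω) ∂Q ≤
      ∫⁻ ω in A, ENNReal.ofReal (M s ω) ∂Q := fun m => by
    set B := A ∩ {ω | (s : WithTop ℝ≥0) < τ m ω} with hB
    have hBm : MeasurableSet B := 𝓕.le s _ (hAs m)
    calc ∫⁻ ω in B, ENNReal.ofReal (M t ω) ∂Q
        ≤ ∫⁻ ω in B, liminf (fun n => ENNReal.ofReal (Y n t ω)) atTop ∂Q := by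
          refine lintegral_mono_ae (ae_restrict_of_ae ?_)
          filter_upwards [hlt] with ω hω
          have : (fun n => ENNReal.ofReal (Y n t ω)) =ᶠ[atTop]
              fun _ => ENNReal.ofReal (M t ω) := by
            filter_upwards [hω t] with n hn
            rw [hYeq n t ω hn]
          rw [liminf_congr this, liminf_const]
      _ ≤ liminf (fun n => ∫⁻ ω in B, ENNReal.ofReal (Y n t ω) ∂Q) atTop :=
          lintegral_liminf_le fun n => (hYm n t).ennreal_ofReal
      _ = liminf (fun n => ∫⁻ ω in B, ENNReal.ofReal (Y n s ω) ∂Q) atTop := by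
          congr 1
          ext n
          rw [hofReal, hofReal, (h n).setIntegral_eq hst (hAs m)]
      _ = liminf (fun _ : ℕ => ∫⁻ ω in B, ENNReal.ofReal (M s ω) ∂Q) atTop := by
          refine liminf_congr ?_
          filter_upwards [eventually_ge_atTop m] with n hn
          refine setLIntegral_congr_fun_ae hBm ?_
          filter_upwards [hτ.mono] with ω hω hωB
          rw [hYeq n s ω (hωB.2.trans_le (hω hn))]
      _ = ∫⁻ ω in B, ENNReal.ofReal (M s ω) ∂Q := liminf_const _
      _ ≤ ∫⁻ ω in A, ENNReal.ofReal (M s ω) ∂Q := lintegral_mono_set Set.inter_subset_left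
  have hAm : MeasurableSet A := 𝓕.le s _ hA
  calc ∫⁻ ω in A, ENNReal.ofReal (M t ω) ∂Q
      = ∫⁻ ω, A.indicator (fun ω => ENNReal.ofReal (M t ω)) ω ∂Q := (lintegral_indicator hAm _).symm
    _ ≤ ∫⁻ ω, liminf (fun m => (A ∩ {ω | (s : WithTop ℝ≥0) < τ m ω}).indicator
          (fun ω => ENNReal.ofReal (M t ω)) ω) atTop ∂Q := by
        refine lintegral_mono_ae ?_
        filter_upwards [hlt] with ω hω
        have : (fun m => (A ∩ {ω | (s : WithTop ℝ≥0) < τ m ω}).indicator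
            (fun ω => ENNReal.ofReal (M t ω)) ω) =ᶠ[atTop]
            fun _ => A.indicator (fun ω => ENNReal.ofReal (M t ω)) ω := by
          filter_upwards [hω s] with m hm
          by_cases hωA : ω ∈ A
          · have hmem : ω ∈ A ∩ {ω | (s : WithTop ℝ≥0) < τ m ω} := ⟨hωA, hm⟩
            rw [Set.indicator_of_mem hmem, Set.indicator_of_mem hωA]
          · rw [Set.indicator_of_notMem fun h => hωA h.1, Set.indicator_of_notMem hωA]
        rw [liminf_congr this, liminf_const]
    _ ≤ liminf (fun m => ∫⁻ ω, (A ∩ {ω | (s : WithTop ℝ≥0) < τ m ω}).indicator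
          (fun ω => ENNReal.ofReal (M t ω)) ω ∂Q) atTop :=
        lintegral_liminf_le fun m => (hMm t).ennreal_ofReal.indicator (𝓕.le s _ (hAs m))
    _ ≤ liminf (fun _ : ℕ => ∫⁻ ω in A, ENNReal.ofReal (M s ω) ∂Q) atTop := by
        refine liminf_le_liminf (Eventually.of_forall fun m => ?_)
        rw [lintegral_indicator (𝓕.le s _ (hAs m))]
        exact hm m
    _ = ∫⁻ ω in A, ENNReal.ofReal (M s ω) ∂Q := liminf_const _

theorem IsLocalMartingale.integrable_of_nonneg (hM : IsLocalMartingale Q 𝓕 M)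
    (hadap : StronglyAdapted 𝓕 M) (hnn : ∀ᵐ ω ∂Q, ∀ t, 0 ≤ M t ω)
    (h0 : Integrable (M 0) Q) (t : ℝ≥0) :
    Integrable (M t) Q := by
  have hm : AEStronglyMeasurable (M t) Q := ((hadap t).mono (𝓕.le t)).aestronglyMeasurable
  refine (lintegral_ofReal_ne_top_iff_integrable hm (hnn.mono fun ω h => h t)).1 ?_
  have h1 := hM.setLIntegral_mono hadap hnn (zero_le : 0 ≤ t) (A := Set.univ) MeasurableSet.univ
  rw [setLIntegral_univ, setLIntegral_univ] at h1
  exact ne_top_of_le_ne_top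
    ((lintegral_ofReal_ne_top_iff_integrable h0.1 (hnn.mono fun ω h => h 0)).2 h0) h1

theorem IsLocalMartingale.setIntegral_anti (hM : IsLocalMartingale Q 𝓕 M)
    (hadap : StronglyAdapted 𝓕 M) (hnn : ∀ᵐ ω ∂Q, ∀ t, 0 ≤ M t ω)
    (h0 : Integrable (M 0) Q) {s t : ℝ≥0} (hst : s ≤ t)
    {A : Set Ω} (hA : MeasurableSet[𝓕 s] A) : ∫ ω in A, M t ω ∂Q ≤ ∫ ω in A, M s ω ∂Q := by
  have hi := hM.integrable_of_nonneg hadap hnn h0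
  have hs : ∀ r, 0 ≤ᵐ[Q.restrict A] M r := fun r => ae_restrict_of_ae (hnn.mono fun ω h => h r)
  have h1 := hM.setLIntegral_mono hadap hnn hst hA
  rw [← ofReal_integral_eq_lintegral_ofReal (hi t).integrableOn (hs t),
    ← ofReal_integral_eq_lintegral_ofReal (hi s).integrableOn (hs s)] at h1
  exact (ENNReal.ofReal_le_ofReal_iff (integral_nonneg_of_ae (hs s))).1 h1

/-- A nonnegative local martingale is a martingale iff its expectation is constant along the
integers. -/
theorem IsLocalMartingale.martingale_iff (hM : IsLocalMartingale Q 𝓕 M)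
    (hadap : StronglyAdapted 𝓕 M) (hnn : ∀ᵐ ω ∂Q, ∀ t, 0 ≤ M t ω)
    (h0 : Integrable (M 0) Q) :
    Martingale M 𝓕 Q ↔ ∀ N : ℕ, ∫ ω, M N ω ∂Q = ∫ ω, M 0 ω ∂Q := by
  refine ⟨fun h N => ?_, fun h => ?_⟩
  · simpa using (h.setIntegral_eq (zero_le : (0 : ℝ≥0) ≤ N) (s := Set.univ) MeasurableSet.univ).symm
  have hi := hM.integrable_of_nonneg hadap hnn h0
  have hanti : ∀ s t : ℝ≥0, s ≤ t → ∫ ω, M t ω ∂Q ≤ ∫ ω, M s ω ∂Q := fun s t hst => by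
    simpa using hM.setIntegral_anti hadap hnn h0 hst (A := Set.univ) MeasurableSet.univ
  have hconst : ∀ t : ℝ≥0, ∫ ω, M t ω ∂Q = ∫ ω, M 0 ω ∂Q := fun t => by
    obtain ⟨N, hN⟩ := exists_nat_ge t
    exact le_antisymm (hanti 0 t zero_le) ((h N).symm.le.trans (hanti t N hN))
  refine ⟨hadap, fun s t hst => ?_⟩
  refine (ae_eq_condExp_of_forall_setIntegral_eq (𝓕.le s) (hi t)
    (fun A _ _ => (hi s).integrableOn) (fun A hA _ => ?_)
    (hadap s).aestronglyMeasurable).symm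
  -- The inequalities on `A` and on its complement add up to an equality, so each is an equality.
  have h1 := hM.setIntegral_anti hadap hnn h0 hst hA
  have h2 := hM.setIntegral_anti hadap hnn h0 hst hA.compl
  have h3 := integral_add_compl (𝓕.le s _ hA) (hi s)
  have h4 := integral_add_compl (𝓕.le s _ hA) (hi t)
  rw [hconst] at h3 h4
  linarith

end LocalMartingale

/-! ### Limits of call prices -/

section CallPrice

variable {Ω : Type*} [MeasurableSpace Ω] {Q : Measure Ω} {x₀ α : ℝ} {X : ℝ≥0 → Ω → ℝ} {T : ℝ≥0}

theorem tendsto_callPrice_zero (hX : Integrable (X T) Q) (hnn : ∀ᵐ ω ∂Q, 0 ≤ X T ω)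
    {κ : ℕ → ℝ} (hκ0 : ∀ k, 0 ≤ κ k) (hκ : Tendsto κ atTop (𝓝 0)) :
    Tendsto (fun k => callPrice Q x₀ α X T (κ k)) atTop
      (𝓝 (∫ ω, X T ω ∂Q + α * (x₀ - ∫ ω, X T ω ∂Q))) := by
  refine Tendsto.add_const _ ?_
  refine tendsto_integral_of_dominated_convergence (X T)
    (fun k => ((hX.1.sub aestronglyMeasurable_const).sup aestronglyMeasurable_const)) hX
    (fun k => ?_) ?_
  · filter_upwards [hnn] with ω hω
    rw [Real.norm_of_nonneg (le_max_right _ _)]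
    exact max_le (by linarith [hκ0 k]) hω
  · filter_upwards [hnn] with ω hω
    have : Tendsto (fun k => max (X T ω - κ k) 0) atTop (𝓝 (max (X T ω - 0) 0)) :=
      (tendsto_const_nhds.sub hκ).max tendsto_const_nhds
    rwa [sub_zero, max_eq_left hω] at this

theorem tendsto_callPrice_atTop (hX : Integrable (X T) Q) (hnn : ∀ᵐ ω ∂Q, 0 ≤ X T ω)
    {κ : ℕ → ℝ} (hκ0 : ∀ k, 0 ≤ κ k) (hκ : Tendsto κ atTop atTop) :
    Tendsto (fun k => callPrice Q x₀ α X T (κ k)) atTop (𝓝 (α * (x₀ - ∫ ω, X T ω ∂Q))) := by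
  rw [← zero_add (α * _)]
  refine Tendsto.add_const _ ?_
  have hz : ∫ _ : Ω, (0 : ℝ) ∂Q = 0 := integral_zero Ω ℝ
  nth_rewrite 2 [← hz]
  refine tendsto_integral_of_dominated_convergence (X T)
    (fun k => ((hX.1.sub aestronglyMeasurable_const).sup aestronglyMeasurable_const)) hX
    (fun k => ?_) (ae_of_all _ fun ω => ?_)
  · filter_upwards [hnn] with ω hω
    rw [Real.norm_of_nonneg (le_max_right _ _)]
    exact max_le (by linarith [hκ0 k]) hω
  · refine tendsto_const_nhds.congr' ?_
    filter_upwards [hκ.eventually_ge_atTop (X T ω)] with k hk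
    exact (max_eq_right (by linarith)).symm

end CallPrice

/-! ### Bubble detection from observed prices -/

section Bubble

variable {Ω : Type*} [mΩ : MeasurableSpace Ω] {Q : Measure Ω}
  {𝓕 : Filtration ℝ≥0 mΩ} {W : ℝ≥0 → Ω → ℝ} {x₀ α : ℝ} {σ : ℝ → ℝ → ℝ} {X : ℝ≥0 → Ω → ℝ}

theorem IsLocalVolSolution.stronglyAdapted (h : IsLocalVolSolution Q 𝓕 W x₀ σ X) :
    StronglyAdapted 𝓕 X := fun t => by
  have := (h.sde.adapted t).add (stronglyMeasurable_const (b := x₀))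
  convert this using 1
  ext ω
  simp

theorem IsLocalVolSolution.isLocalMartingale [IsProbabilityMeasure Q] (h : IsLocalVolSolution Q 𝓕 W x₀ σ X) :
    IsLocalMartingale Q 𝓕 X := by
  simpa using h.sde.localMartingale.add_const x₀

theorem IsLocalVolSolution.ae_zero (h : IsLocalVolSolution Q 𝓕 W x₀ σ X) :
    X 0 =ᵐ[Q] fun _ => x₀ := by
  filter_upwards [h.sde.zero] with ω hω
  linarith

theorem IsLocalVolSolution.integrable [IsProbabilityMeasure Q] (h : IsLocalVolSolution Q 𝓕 W x₀ σ X) (t : ℝ≥0) :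
    Integrable (X t) Q :=
  h.isLocalMartingale.integrable_of_nonneg h.stronglyAdapted h.nonneg
    ((integrable_const x₀).congr h.ae_zero.symm) t

theorem IsLocalVolSolution.martingale_iff [IsProbabilityMeasure Q] (h : IsLocalVolSolution Q 𝓕 W x₀ σ X) :
    Martingale X 𝓕 Q ↔ ∀ N : ℕ, ∫ ω, X N ω ∂Q = x₀ := by
  rw [h.isLocalMartingale.martingale_iff h.stronglyAdapted h.nonneg (h.integrable 0),
    integral_congr_ae h.ae_zero]
  simp

/-- Strikes in the observation region that converge to `0` if `α < 1` and to `∞` if `α = 1`. -/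
noncomputable def limitStrike (α δ C : ℝ) (k : ℕ) : ℝ :=
  if α < 1 then δ / (k + 1) else C + k

theorem limitStrike_pos {δ C : ℝ} (hδ : 0 < δ) (hC : 0 < C) (k : ℕ) : 0 < limitStrike α δ C k := by
  unfold limitStrike
  split_ifs <;> positivity

theorem mem_observationRegion_limitStrike {δ C : ℝ} (hδ : 0 < δ) (N k : ℕ) :
    ((N : ℝ), limitStrike α δ C k) ∈ observationRegion α δ C := by
  unfold limitStrike observationRegion
  have hk : (0 : ℝ) ≤ k := k.cast_nonneg
  split_ifs
  · exact ⟨N.cast_nonneg (α := ℝ), by positivity, div_le_self hδ.le (by linarith)⟩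
  · exact ⟨N.cast_nonneg (α := ℝ), by simp⟩

/-- The limit of the prices at the strikes `limitStrike` in the absence of a bubble. -/
noncomputable def limitPrice (x₀ α : ℝ) : ℝ := if α < 1 then x₀ else 0

theorem IsPriceSurface.tendsto_limitPrice_iff [IsProbabilityMeasure Q] {f : C12}
    (hf : IsPriceSurface Q 𝓕 W x₀ α σ X f)
    (hα : α ≤ 1) {δ C : ℝ} (hδ : 0 < δ) (hC : 0 < C) (N : ℕ) :
    Tendsto (fun k => f.toFun N (limitStrike α δ C k)) atTop (𝓝 (limitPrice x₀ α)) ↔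
      ∫ ω, X N ω ∂Q = x₀ := by
  have hX := hf.solution.integrable N
  have hnn : ∀ᵐ ω ∂Q, 0 ≤ X N ω := hf.solution.nonneg.mono fun ω h => h N
  have hpos := limitStrike_pos (α := α) hδ hC
  have hprice : (fun k => f.toFun N (limitStrike α δ C k)) =
      fun k => callPrice Q x₀ α X N (limitStrike α δ C k) :=
    funext fun k => by simpa using hf.price N _ (hpos k)
  rw [hprice]
  by_cases h1 : α < 1
  · have hκ : Tendsto (limitStrike α δ C) atTop (𝓝 0) := by
      have : limitStrike α δ C = fun k : ℕ => δ * (1 / ((k : ℝ) + 1)) := by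
        ext k; simp [limitStrike, h1, div_eq_mul_inv]
      rw [this]
      simpa using tendsto_one_div_add_atTop_nhds_zero_nat.const_mul δ
    have hlim := tendsto_callPrice_zero (x₀ := x₀) (α := α) hX hnn (fun k => (hpos k).le) hκ
    simp only [limitPrice, h1, if_true]
    constructor
    · intro h
      have := tendsto_nhds_unique h hlim
      have h2 : (1 - α) * (∫ ω, X N ω ∂Q - x₀) = 0 := by linear_combination -this
      rcases mul_eq_zero.1 h2 with h3 | h3 <;> linarith
    · intro h
      simpa [h] using hlim
  · have hα1 : α = 1 := le_antisymm hα (not_lt.1 h1)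
    have hκ : Tendsto (limitStrike α δ C) atTop atTop := by
      have : limitStrike α δ C = fun k : ℕ => C + (k : ℝ) := by
        ext k; simp [limitStrike, h1]
      rw [this]
      exact tendsto_atTop_add_const_left _ _ tendsto_natCast_atTop_atTop
    have hlim := tendsto_callPrice_atTop (x₀ := x₀) (α := α) hX hnn (fun k => (hpos k).le) hκ
    simp only [limitPrice, h1, if_false]
    constructor
    · intro h
      have := tendsto_nhds_unique h hlim
      rw [hα1] at this
      linarith
    · intro h
      simpa [h] using hlim

open Classical in
/-- The bubble indicator is a function of the prices at the strikes `limitStrike`. -/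
theorem bubbleIndicator_eq [IsProbabilityMeasure Q] (hα : α ≤ 1) {δ C : ℝ} (hδ : 0 < δ) (hC : 0 < C)
    (g : priceSpace Q 𝓕 W x₀ α) :
    bubbleIndicator Q 𝓕 W x₀ α g =
      if ∀ N : ℕ, Tendsto (fun k => g.1.toFun N (limitStrike α δ C k)) atTop
        (𝓝 (limitPrice x₀ α)) then 0 else 1 := by
  -- The right-hand side involves only the surface `g`, so all pairs `(σ, X)` generating `g` agree
  -- on the martingale property.
  have hiff : ∀ {σ X}, IsPriceSurface Q 𝓕 W x₀ α σ X g.1 → (Martingale X 𝓕 Q ↔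
      ∀ N : ℕ, Tendsto (fun k => g.1.toFun N (limitStrike α δ C k)) atTop
        (𝓝 (limitPrice x₀ α))) := fun h => by
    rw [h.solution.martingale_iff]
    exact forall_congr' fun N => (h.tendsto_limitPrice_iff hα hδ hC N).symm
  unfold bubbleIndicator
  split_ifs with h1 h2 h2
  · obtain ⟨σ, X, h, -, hX⟩ := h1
    exact absurd ((hiff h).2 h2) hX
  · rfl
  · rfl
  · obtain ⟨σ, X, h⟩ := g.2
    exact absurd ⟨σ, X, h, h.solution.isLocalMartingale, fun hX => h2 ((hiff h).1 hX)⟩ h1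

end Bubble

/-! ### Evaluation of price surfaces -/

section Evaluation

theorem C12.continuous_eval {t x : ℝ} (ht : 0 ≤ t) (hx : 0 < x) :
    Continuous fun f : C12 => f.toFun t x := by
  refine continuous_iff_continuousAt.2 fun f₀ => Metric.tendsto_nhds.2 fun r hr => ?_
  obtain ⟨n, hn⟩ := exists_nat_ge (max (max t x) (max x⁻¹ 1))
  simp only [max_le_iff] at hn
  obtain ⟨⟨htn, hxn⟩, hxn', hn1⟩ := hn
  have hmem : (t, x) ∈ C12.region 0 n := by
    rw [C12.region, if_pos rfl]
    exact ⟨⟨ht, htn⟩, inv_le_of_inv_le₀ hx hxn', hxn⟩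
  have hopen : IsOpen {f | C12.seminormDist 0 n f f₀ < r} :=
    TopologicalSpace.isOpen_generateFrom_of_mem ⟨0, n, f₀, r, by exact_mod_cast hn1, rfl⟩
  have hf₀ : f₀ ∈ {f | C12.seminormDist 0 n f f₀ < r} := by
    refine lt_of_le_of_lt (Real.sSup_nonpos ?_) hr
    rintro _ ⟨p, -, rfl⟩
    simp
  filter_upwards [hopen.mem_nhds hf₀] with f hf
  refine lt_of_le_of_lt ?_ hf
  have hsub : C12.region 0 n ⊆ Set.Ici 0 ×ˢ Set.Ioi 0 := by
    rw [C12.region, if_pos rfl]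
    exact Set.prod_mono Set.Icc_subset_Ici_self
      fun y hy => lt_of_lt_of_le (inv_pos.2 (by linarith)) hy.1
  have hcomp : IsCompact (C12.region 0 n) := by
    rw [C12.region, if_pos rfl]
    exact isCompact_Icc.prod isCompact_Icc
  have hcont : ContinuousOn (fun p => |f.partialDeriv 0 p - f₀.partialDeriv 0 p|)
      (C12.region 0 n) :=
    ((f.continuousOn.mono hsub).sub (f₀.continuousOn.mono hsub)).abs
  -- Boundedness matters: the real supremum of an unbounded set is `0` by default.
  exact le_csSup (hcomp.bddAbove_image hcont) ⟨(t, x), hmem, rfl⟩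

/-- Unobserved prices are pointwise limits of observed ones. The σ-algebra is arbitrary so that it
can be the one generated by the observations. -/
theorem C12.measurable_eval_of_mem_closure {E : Type*} {m : MeasurableSpace E} {S : E → C12}
    {T K : ℕ → ℝ} (hTK : ∀ i, 0 ≤ T i ∧ 0 < K i)
    (h : ∀ i, Measurable fun g => (S g).toFun (T i) (K i)) {t x : ℝ} (ht : 0 ≤ t) (hx : 0 < x)
    (hmem : (t, x) ∈ closure (Set.range fun i => (T i, K i))) :
    Measurable fun g => (S g).toFun t x := by
  obtain ⟨y, hy, hlim⟩ := mem_closure_iff_seq_limit.1 hmem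
  choose i hi using hy
  refine measurable_of_tendsto_metrizable (fun j => h (i j)) (tendsto_pi_nhds.2 fun g => ?_)
  have hc := (S g).continuousOn (t, x) ⟨ht, hx⟩
  have hw : Tendsto (fun j => (T (i j), K (i j))) atTop (𝓝[Set.Ici 0 ×ˢ Set.Ioi 0] (t, x)) :=
    tendsto_nhdsWithin_iff.2 ⟨hlim.congr fun j => (hi j).symm, Eventually.of_forall fun j => hTK _⟩
  exact hc.tendsto.comp hw

end Evaluation

/-! ### Networks on finitely many observations -/

section Observations

theorem abs_clamp_sub_le {a b : ℝ} (hb : b ∈ Set.Icc (0 : ℝ) 1) :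
    |max 0 (min 1 a) - b| ≤ |a - b| := by
  have h : max 0 (min 1 b) = b := by rw [min_eq_right hb.2, max_eq_right hb.1]
  calc |max 0 (min 1 a) - b| = |max 0 (min 1 a) - max 0 (min 1 b)| := by rw [h]
    _ ≤ |min 1 a - min 1 b| := by
        rw [max_comm 0, max_comm 0]
        exact abs_max_sub_max_le_abs _ _ _
    _ ≤ |a - b| := (abs_min_sub_min_le_max 1 a 1 b).trans (by simp)

theorem exists_isNeuralNetwork_comp_integral_lt {ς ψ : ℝ → ℝ} (hς : IsInnerActivation ς)
    (hψ : IsOuterActivation ψ) {L : ℕ} (hL : 2 ≤ L) {E : Type*} [mE : MeasurableSpace E]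
    (μ : Measure E) [IsProbabilityMeasure μ] {obs : ℕ → E → ℝ} (hobs : ∀ i, Measurable (obs i))
    {F : E → ℝ} (hF01 : ∀ g, F g ∈ Set.Icc (0 : ℝ) 1)
    (hF : Measurable[⨆ i, MeasurableSpace.comap (obs i) inferInstance] F) {ε : ℝ} (hε : 0 < ε) :
    ∃ (n : ℕ) (G : (Fin n → ℝ) → ℝ), 1 ≤ n ∧ IsNeuralNetwork ς ψ L n G ∧ Continuous G ∧
      (∀ c, G c ∈ Set.Icc (0 : ℝ) 1) ∧ ∫ g, |G (fun i => obs i g) - F g| ∂μ < ε := by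
  -- Using `n + 1` observations guarantees at least one network input.
  let V : (n : ℕ) → E → Fin (n + 1) → ℝ := fun n g i => obs i g
  have hV : ∀ n, Measurable (V n) := fun n => measurable_pi_lambda _ fun i => hobs i
  let 𝒢 : Filtration ℕ mE :=
    { seq := fun n => MeasurableSpace.comap (V n) inferInstance
      mono' := fun a b hab => by
        have h : Measurable fun (c : Fin (b + 1) → ℝ) (i : Fin (a + 1)) =>
            c (Fin.castLE (by omega) i) := measurable_pi_lambda _ fun i => measurable_pi_apply _
        exact (h.comp (comap_measurable (V b))).comap_le
      le' := fun n => (hV n).comap_le }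
  have hle : (⨆ i, MeasurableSpace.comap (obs i) inferInstance) ≤ ⨆ n, 𝒢 n := by
    refine iSup_le fun i => le_iSup_of_le i ?_
    have : Measurable[𝒢 i] (obs i) :=
      (measurable_pi_apply (Fin.last i)).comp (comap_measurable (V i))
    exact this.comap_le
  have hFE : Measurable F := hF.mono (iSup_le fun i => (hobs i).comap_le) le_rfl
  have hFi : Integrable F μ := by
    refine Integrable.of_bound hFE.aestronglyMeasurable 1 (ae_of_all _ fun x => ?_)
    rw [Real.norm_of_nonneg (hF01 x).1]
    exact (hF01 x).2
  have hFsm : StronglyMeasurable[⨆ n, 𝒢 n] F := (hF.mono hle le_rfl).stronglyMeasurable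
  obtain ⟨n, hn⟩ := ((hFi.tendsto_eLpNorm_condExp hFsm).eventually
    (gt_mem_nhds (ENNReal.ofReal_pos.2 (half_pos hε)))).exists
  obtain ⟨φ, hφ, hφeq⟩ := (stronglyMeasurable_condExp :
    StronglyMeasurable[𝒢 n] (μ[F|𝒢 n])).exists_eq_measurable_comp
  have hci : Integrable (μ[F|𝒢 n] - F) μ := integrable_condExp.sub hFi
  have hn' : ∫ g, |φ (V n g) - F g| ∂μ < ε / 2 := by
    rw [eLpNorm_one_eq_lintegral_enorm, ← ofReal_integral_norm_eq_lintegral_enorm hci] at hn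
    have := (ENNReal.ofReal_lt_ofReal_iff (half_pos hε)).1 hn
    rw [hφeq] at this
    exact this
  -- The Doob–Dynkin factor `φ` may leave `[0,1]`; clamping does not increase the distance to `F`.
  let f : (Fin (n + 1) → ℝ) → ℝ := fun c => max 0 (min 1 (φ c))
  have hf : Measurable f := measurable_const.max (measurable_const.min hφ.measurable)
  have hf01 : ∀ c, f c ∈ Set.Icc (0 : ℝ) 1 := fun c =>
    ⟨le_max_left _ _, max_le zero_le_one (min_le_left _ _)⟩
  have : IsProbabilityMeasure (μ.map (V n)) := Measure.isProbabilityMeasure_map (hV n).aemeasurable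
  obtain ⟨G, hG, hGc, hG01, hGf⟩ :=
    exists_isNeuralNetwork_integral_lt hς hψ hL (μ.map (V n)) hf hf01 (half_pos hε)
  have hb : ∀ {u v : E → ℝ}, Measurable u → Measurable v → (∀ g, u g ∈ Set.Icc (0 : ℝ) 1) →
      (∀ g, v g ∈ Set.Icc (0 : ℝ) 1) → Integrable (fun g => |u g - v g|) μ := fun hu hv hu1 hv1 => by
    refine Integrable.of_bound (hu.sub hv).abs.aestronglyMeasurable 1 (ae_of_all _ fun g => ?_)
    rw [Real.norm_eq_abs, abs_abs, abs_le]
    constructor <;> linarith [(hu1 g).1, (hu1 g).2, (hv1 g).1, (hv1 g).2]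
  have hi1 := hb (hGc.measurable.comp (hV n)) (hf.comp (hV n)) (fun g => hG01 _) (fun g => hf01 _)
  have hi2 : Integrable (fun g => |φ (V n g) - F g|) μ := by
    rw [hφeq] at hci
    exact hci.abs
  have hGfm : Measurable fun c => |G c - f c| := (hGc.measurable.sub hf).abs
  rw [integral_map (hV n).aemeasurable hGfm.aestronglyMeasurable] at hGf
  refine ⟨n + 1, G, by omega, hG, hGc, hG01, ?_⟩
  calc ∫ g, |G (V n g) - F g| ∂μ
      ≤ ∫ g, (|G (V n g) - f (V n g)| + |φ (V n g) - F g|) ∂μ := by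
        refine integral_mono_of_nonneg (ae_of_all _ fun g => abs_nonneg _) (hi1.add hi2)
          (ae_of_all _ fun g => ?_)
        exact (abs_sub_le _ (f (V n g)) _).trans (add_le_add le_rfl (abs_clamp_sub_le (hF01 g)))
    _ = ∫ g, |G (V n g) - f (V n g)| ∂μ + ∫ g, |φ (V n g) - F g| ∂μ := integral_add hi1 hi2
    _ < ε := by linarith

end Observations

theorem mem_domain_of_mem_observationRegion {α δ C : ℝ} (hC : 0 < C) {p : ℝ × ℝ}
    (hp : p ∈ observationRegion α δ C) : 0 ≤ p.1 ∧ 0 < p.2 := by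
  unfold observationRegion at hp
  split_ifs at hp
  · exact ⟨hp.1, hp.2.1⟩
  · exact ⟨hp.1, hC.trans_le hp.2⟩

/-! ### The main theorem

The indicator of a bubble is measurable with respect to the observed prices: prices are continuous,
the observations are dense, and the limits of the prices in the strike determine the expectations
`E[X_N]`, which are constant exactly for martingales. So its conditional expectations given finitely
many observations converge to it, whatever the law `μ`; the hypothesis on `μ` is not needed. -/

theorem mainTheorem4 {Ω : Type*} [mΩ : MeasurableSpace Ω]
    (Q : Measure Ω) [IsProbabilityMeasure Q]
    (𝓕 : Filtration ℝ≥0 mΩ) (h𝓕 : UsualConditions Q 𝓕)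
    (W : ℝ≥0 → Ω → ℝ) (hW : IsFiltrationBrownian Q 𝓕 W)
    (x₀ : ℝ) (hx₀ : 0 < x₀) (α : ℝ) (hα : α ∈ Set.Icc (0 : ℝ) 1)
    -- maturities and strikes, dense in the observation region
    (δ C : ℝ) (hδ : 0 < δ) (hC : 0 < C) (T K : ℕ → ℝ)
    (hTK : ∀ i, (T i, K i) ∈ observationRegion α δ C)
    (hdense : observationRegion α δ C ⊆ closure (Set.range fun i => (T i, K i)))
    -- the measure on the space of price surfaces
    (μ : Measure (priceSpace Q 𝓕 W x₀ α)) [IsProbabilityMeasure μ]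
    (hμ : ∃ ν : Measure (priceSpace Q 𝓕 W x₀ α), IsProbabilityMeasure ν ∧
      ∀ g ∈ μ.support, 0 < ν {f | ∀ i, f.1.toFun (T i) (K i) = g.1.toFun (T i) (K i)})
    -- the architecture: activations and depth
    (ς : ℝ → ℝ) (hς : IsInnerActivation ς) (ψ : ℝ → ℝ) (hψ : IsOuterActivation ψ)
    (L : ℕ) (hL : 2 ≤ L)
    (p : ℝ) (hp : 1 ≤ p) (ε : ℝ) (hε : 0 < ε) :
    ∃ (n : ℕ) (Fhat : (Fin n → ℝ) → ℝ), 1 ≤ n ∧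
      IsNeuralNetwork ς ψ L n Fhat ∧ (∀ c, Fhat c ∈ Set.Icc (0 : ℝ) 1) ∧
      MemLp (fun g : priceSpace Q 𝓕 W x₀ α =>
        Fhat (fun i : Fin n => g.1.toFun (T i) (K i)) - bubbleIndicator Q 𝓕 W x₀ α g)
        (ENNReal.ofReal p) μ ∧
      (∫ g : priceSpace Q 𝓕 W x₀ α,
        |Fhat (fun i : Fin n => g.1.toFun (T i) (K i)) - bubbleIndicator Q 𝓕 W x₀ α g| ^ p ∂μ)
        ^ (1 / p) < ε := by
  obtain ⟨-, hα1⟩ := hα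
  have hdom : ∀ i, 0 ≤ T i ∧ 0 < K i := fun i => mem_domain_of_mem_observationRegion hC (hTK i)
  let obs : ℕ → priceSpace Q 𝓕 W x₀ α → ℝ := fun i g => g.1.toFun (T i) (K i)
  have hobs : ∀ i, Measurable (obs i) := fun i =>
    (C12.continuous_eval (hdom i).1 (hdom i).2).measurable.comp measurable_subtype_coe
  have hF01 : ∀ g, bubbleIndicator Q 𝓕 W x₀ α g ∈ Set.Icc (0 : ℝ) 1 := fun g => by
    unfold bubbleIndicator
    split_ifs <;> simp
  have hF : Measurable[⨆ i, MeasurableSpace.comap (obs i) inferInstance]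
      (bubbleIndicator Q 𝓕 W x₀ α) := by
    classical
    let m : MeasurableSpace (priceSpace Q 𝓕 W x₀ α) :=
      ⨆ i, MeasurableSpace.comap (obs i) inferInstance
    have heval : ∀ N k : ℕ, Measurable[m] fun g : priceSpace Q 𝓕 W x₀ α =>
        g.1.toFun N (limitStrike α δ C k) := fun N k =>
      C12.measurable_eval_of_mem_closure (m := m) (S := Subtype.val) hdom
        (fun i => (comap_measurable (obs i)).mono 
          (le_iSup (fun i => MeasurableSpace.comap (obs i) inferInstance) i) le_rfl) N.cast_nonneg
        (limitStrike_pos hδ hC k) (hdense (mem_observationRegion_limitStrike hδ N k))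
    rw [funext (bubbleIndicator_eq (𝓕 := 𝓕) (Q := Q) (W := W) (x₀ := x₀) hα1 hδ hC)]
    refine Measurable.ite ?_ measurable_const measurable_const
    simp only [Set.ofPred_forall]
    exact MeasurableSet.iInter fun N => measurableSet_tendsto _ (heval N)
  have hFE : Measurable (bubbleIndicator Q 𝓕 W x₀ α) :=
    hF.mono (iSup_le fun i => (hobs i).comap_le) le_rfl
  have hp0 : 0 < p := by linarith
  -- The `L¹` tolerance is `ε ^ p`, because an error bounded by `1` dominates its own `p`-th power.
  obtain ⟨n, G, hn, hG, hGc, hG01, hlt⟩ := exists_isNeuralNetwork_comp_integral_lt hς hψ hL μ hobs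
    hF01 hF (Real.rpow_pos_of_pos hε p)
  have hVm : Measurable fun (g : priceSpace Q 𝓕 W x₀ α) (i : Fin n) => obs i g :=
    measurable_pi_lambda _ fun i => hobs i
  have hD : Measurable fun g => G (fun i : Fin n => obs i g) - bubbleIndicator Q 𝓕 W x₀ α g :=
    (hGc.measurable.comp hVm).sub hFE
  have hD1 : ∀ g, |G (fun i : Fin n => obs i g) - bubbleIndicator Q 𝓕 W x₀ α g| ≤ 1 := fun g => by
    have h1 := hG01 (fun i : Fin n => obs i g)
    have h2 := hF01 g
    rw [abs_le]
    constructor <;> linarith [h1.1, h1.2, h2.1, h2.2]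
  refine ⟨n, G, hn, hG, hG01, MemLp.of_bound hD.aestronglyMeasurable 1 (ae_of_all _ hD1), ?_⟩
  have hle : ∫ g, |G (fun i : Fin n => obs i g) - bubbleIndicator Q 𝓕 W x₀ α g| ^ p ∂μ ≤
      ∫ g, |G (fun i : Fin n => obs i g) - bubbleIndicator Q 𝓕 W x₀ α g| ∂μ := by
    refine integral_mono_of_nonneg (ae_of_all _ fun g => by positivity)
      (Integrable.of_bound hD.abs.aestronglyMeasurable 1
        (ae_of_all _ fun g => by rw [Real.norm_eq_abs, abs_abs]; exact hD1 g))
      (ae_of_all _ fun g => ?_)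
    exact Real.rpow_le_self_of_le_one (abs_nonneg _) (hD1 g) hp
  calc _ < (ε ^ p) ^ (1 / p) :=
        Real.rpow_lt_rpow (integral_nonneg fun g => by positivity) (hle.trans_lt hlt)
          (by positivity)
    _ = ε := by rw [one_div, Real.rpow_rpow_inv hε.le hp0.ne']
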